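/- Let $T>0$ and $d\in\mathbb{N}$, let $\Omega=C_0([0,T];\mathbb{R}^d)$ be the space of continuous functions $\omega:[0,T]\to\mathbb{R}^d$ with $\omega_0=0$ (with the supremum norm), and let $P$ be the Wiener measure on the Borel $\sigma$-algebra of $\Omega$, i.e. the probability measure under which the coordinate process $B_s(\omega)=\omega_s$, $s\in[0,T]$, is a $d$-dimensional Brownian motion. Let $\mathcal{F}_T=\sigma\{B_r,\ r\le T\}\vee\mathcal{N}_P$, where $\mathcal{N}_P$ is the set of all $P$-null subsets of $\Omega$. Let $H$ be the Cameron–Martin space of all absolutely continuous $h\in\Omega$ whose derivative belongs to $L^2([0,T];\mathbb{R}^d)$, i.e. of all $h\in\Omega$ of the form $h_t=\int_0^t\dot h_s\,ds$, $t\in[0,T]$, with $\dot h\in L^2([0,T];\mathbb{R}^d)$, and for $h\in H$ let $\tau_h:\Omega\to\Omega$, $\tau_h\omega=\omega+h$. **Lemma 4.1.** Let $\zeta:\Omega\to\mathbb{R}$ be an $\mathcal{F}_T$-measurable random variable such that, for every $h\in H$, $\zeta\circ\tau_h=\zeta$ $P$-a.s. (the exceptional null set may depend on $h$). Then $\zeta$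 is $P$-integrable and $\zeta=E[\zeta]$ $P$-a.s. -/

import Mathlib

open MeasureTheory ProbabilityTheory

noncomputable section

/-- The path space `C₀([0, T]; ℝᵈ)`: continuous functions from `[0, T]` to `ℝᵈ` starting from `0`,
with the supremum norm. -/
def PathSpace (d : ℕ) (T : ℝ) : Submodule ℝ C(Set.Icc (0 : ℝ) T, EuclideanSpace ℝ (Fin d)) where
  carrier := {ω | ∀ t : Set.Icc (0 : ℝ) T, (t : ℝ) = 0 → ω t = 0}
  zero_mem' := fun _ _ => rfl
  add_mem' := fun {a b} ha hb t ht => by simp [ha t ht, hb t ht]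
  smul_mem' := fun c a ha t ht => by simp [ha t ht]

/-- The Borel `σ`-algebra of the path space. -/
instance PathSpace.instMeasurableSpace (d : ℕ) (T : ℝ) : MeasurableSpace (PathSpace d T) :=
  borel _

instance PathSpace.instBorelSpace (d : ℕ) (T : ℝ) : BorelSpace (PathSpace d T) :=
  ⟨rfl⟩

/-- The coordinate process `B_t(ω) = ω_t`. -/
def coordProcess (d : ℕ) (T : ℝ) (t : Set.Icc (0 : ℝ) T) (ω : PathSpace d T) :
    EuclideanSpace ℝ (Fin d) :=
  ω.1 t

/-- `P` is the Wiener measure: the Borel probability measure on the path space under which the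
coordinate process (which is continuous and starts from `0`) is a `d`-dimensional Brownian motion,
i.e. has independent increments with `B_t - B_s ∼ N(0, (t - s) I_d)` for `s ≤ t`. -/
structure IsWienerMeasure {d : ℕ} {T : ℝ} (P : Measure (PathSpace d T)) : Prop where
  isProbabilityMeasure : IsProbabilityMeasure P
  hasIndepIncrements : HasIndepIncrements (coordProcess d T) P
  hasLaw_increment : ∀ s t : Set.Icc (0 : ℝ) T, s ≤ t →
    HasLaw (fun ω => coordProcess d T t ω - coordProcess d T s ω)
      (multivariateGaussian (0 : EuclideanSpace ℝ (Fin d))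
        (((t : ℝ) - (s : ℝ)) • (1 : Matrix (Fin d) (Fin d) ℝ))) P

/-- The natural filtration of the coordinate process, augmented by all `P`-null sets
(`P` evaluated at an arbitrary set is its outer measure, so that `P N = 0` says that `N` is
contained in a Borel set of measure zero):
`ℱ_s = σ{B_r, r ≤ s} ∨ 𝒩_P`. -/
@[reducible] def augFiltration {d : ℕ} {T : ℝ} (P : Measure (PathSpace d T)) (s : ℝ) :
    MeasurableSpace (PathSpace d T) :=
  (⨆ (r : Set.Icc (0 : ℝ) T) (_ : (r : ℝ) ≤ s),
      MeasurableSpace.comap (coordProcess d T r) inferInstance) ⊔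
    MeasurableSpace.generateFrom {N : Set (PathSpace d T) | P N = 0}

/-- The Cameron–Martin space `H`: the absolutely continuous paths `h` in the path space whose
Radon–Nikodym derivative `φ` is in `L²([0, T]; ℝᵈ)`, i.e. `h_t = ∫₀ᵗ φ_s ds`. -/
def cameronMartin (d : ℕ) (T : ℝ) : Set (PathSpace d T) :=
  {h | ∃ φ : ℝ → EuclideanSpace ℝ (Fin d),
    MemLp φ 2 (volume.restrict (Set.Icc (0 : ℝ) T)) ∧
      ∀ t : Set.Icc (0 : ℝ) T, h.1 t = ∫ s in (0 : ℝ)..(t : ℝ), φ s}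

/-- The shift `τ_h ω = ω + h`. -/
def shift {d : ℕ} {T : ℝ} (h ω : PathSpace d T) : PathSpace d T :=
  ω + h

end

/-!
Let `X = ∑ c_p ω_p` be a finite linear combination of the real coordinates `ω_p = ω_t^j` of the path.
Its covariances with all coordinates are the coordinates of a piecewise linear path `h` in the
Cameron–Martin space. With `k = h / Var[X]`, the residual `W = ω - X k` has coordinates uncorrelated
with `X`; as everything is jointly Gaussian, `W` is independent of `X`
(`IsWienerMeasure.indepFun_residual`).

If `ζ` is invariant under all shifts `ω ↦ ω + a k`, then by Fubini it is a.s. constant along almost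
every line `W + ℝ k`, so it is a.s. a function of `W` (`exists_ae_eq_comp_of_shift_invariant`),
hence independent of `X`. Since `X` is arbitrary, the Cramér–Wold device makes `ζ` independent of every
finite family of coordinates (`indepFun_of_forall_strongDual`), thus of the whole path. The
coordinates generate the Borel `σ`-algebra (`comap_scalarCoord`), so `ζ` is independent of itself
(`IsWienerMeasure.indepFun_self`) and is a.s. constant by the zero-one law.

As `ζ` is only measurable for the augmented `σ`-algebra, the argument is run on a Borel
modification. It is again shift-invariant because the shifts along `k` preserve null sets: `P` is the
image of the product of the law of `W` and a nondegenerate Gaussian law on the line `ℝ k`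
(`quasiMeasurePreserving_smul_add`).
-/

/-! ### Functions invariant under shifts along a line -/

/-- A function that is a.s. invariant under every shift along the line `ℝ k` is a.s. a function of
`W ω = ω - X ω • k` alone. By Fubini, on almost every line `ω + ℝ k` it is Lebesgue-a.e. constant, and
translation invariance of Lebesgue measure lets the base point `ω` be replaced by `W ω`. No relation
between `X` and `k` is needed. -/
theorem exists_ae_eq_comp_of_shift_invariant {E : Type*} [AddCommGroup E] [Module ℝ E]
    [MeasurableSpace E] [MeasurableAdd₂ E] [MeasurableSMul₂ ℝ E] {P : Measure E} [SFinite P]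
    {X : E → ℝ} {W : E → E} {k : E} (hW : Measurable W) (hWX : ∀ ω, W ω + X ω • k = ω)
    {f : E → ℝ} (hf : Measurable f) (hinv : ∀ a : ℝ, ∀ᵐ ω ∂P, f (a • k + ω) = f ω) :
    ∃ y : ℝ, ∀ᵐ ω ∂P, f (y • k + W ω) = f ω := by
  have hms : MeasurableSet {p : ℝ × E | f (p.1 • k + p.2) = f p.2} :=
    measurableSet_eq_fun (by fun_prop) (by fun_prop)
  have hline : ∀ᵐ ω ∂P, ∀ᵐ a : ℝ, f (a • k + ω) = f ω :=
    (Measure.ae_ae_comm hms).1 (ae_of_all _ hinv)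
  have hline' : ∀ᵐ ω ∂P, ∀ᵐ y : ℝ, f (y • k + W ω) = f ω := by
    filter_upwards [hline] with ω hω
    have := (measurePreserving_sub_right (volume : Measure ℝ) (X ω)).quasiMeasurePreserving.ae hω
    filter_upwards [this] with y hy
    rw [← hy]
    rw [eq_sub_of_add_eq (hWX ω)]
    congr 1
    module
  have hms' : MeasurableSet {p : E × ℝ | f (p.2 • k + W p.1) = f p.1} :=
    measurableSet_eq_fun (by fun_prop) (by fun_prop)
  exact ((Measure.ae_ae_comm (p := fun ω y => f (y • k + W ω) = f ω) hms').1 hline').exists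

/-- If the component `W` complementary to `X • k` is independent of `X`, then so is every measurable
function that is a.s. invariant under the shifts along `ℝ k`. -/
theorem indepFun_of_shift_invariant {E : Type*} [AddCommGroup E] [Module ℝ E] [MeasurableSpace E]
    [MeasurableAdd₂ E] [MeasurableSMul₂ ℝ E] {P : Measure E} [SFinite P]
    {X : E → ℝ} {W : E → E} {k : E} (hW : Measurable W) (hWX : ∀ ω, W ω + X ω • k = ω)
    (hind : IndepFun W X P) {f : E → ℝ} (hf : Measurable f)
    (hinv : ∀ a : ℝ, ∀ᵐ ω ∂P, f (a • k + ω) = f ω) : IndepFun f X P := by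
  obtain ⟨y, hy⟩ := exists_ae_eq_comp_of_shift_invariant hW hWX hf hinv
  exact (hind.comp (φ := fun w => f (y • k + w)) (ψ := id) (by fun_prop) measurable_id).congr
    hy .rfl

/-- The qualitative form of the Cameron–Martin theorem: when `X` is independent of the complementary
component `W` and its law is equivalent to Lebesgue measure, the preimages of null sets under shifts
along `ℝ k` are null. -/
theorem quasiMeasurePreserving_smul_add {E : Type*} [AddCommGroup E] [Module ℝ E]
    [MeasurableSpace E] [MeasurableAdd₂ E] [MeasurableSMul₂ ℝ E] {P : Measure E}
    [IsProbabilityMeasure P] {X : E → ℝ} {W : E → E} {k : E} (hX : Measurable X)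
    (hW : Measurable W) (hWX : ∀ ω, W ω + X ω • k = ω) (hind : IndepFun W X P)
    (hXv : P.map X ≪ volume) (hvX : volume ≪ P.map X) (a : ℝ) :
    Measure.QuasiMeasurePreserving (fun ω => a • k + ω) P P := by
  refine ⟨by fun_prop, Measure.AbsolutelyContinuous.mk fun N hN h0 => ?_⟩
  rw [Measure.map_apply (by fun_prop) hN]
  have := Measure.isProbabilityMeasure_map (μ := P) hX.aemeasurable
  have := Measure.isProbabilityMeasure_map (μ := P) hW.aemeasurable
  have hjoint := (indepFun_iff_map_prod_eq_prod_map_map hW.aemeasurable hX.aemeasurable).1 hind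
  have hms : ∀ b : ℝ, MeasurableSet {p : E × ℝ | p.1 + (b + p.2) • k ∉ N} := fun b =>
    measurableSet_preimage (t := Nᶜ) (by fun_prop) hN.compl
  -- the statement for the shift by `b • k`, read on almost every line `w + ℝ k`
  have hkey : ∀ b : ℝ, (∀ᵐ ω ∂P, b • k + ω ∉ N) ↔
      ∀ᵐ w ∂(P.map W), ∀ᵐ x ∂(P.map X), w + (b + x) • k ∉ N := by
    intro b
    rw [← Measure.ae_prod_iff_ae_ae (hms b), ← hjoint,
      ae_map_iff (by fun_prop) (hms b)]
    refine Filter.eventually_congr (ae_of_all _ fun ω => ?_)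
    have : W ω + (b + X ω) • k = b • k + ω := by
      rw [eq_sub_of_add_eq (hWX ω)]
      module
    simp only [this]
  have hN0 : ∀ᵐ ω ∂P, (0 : ℝ) • k + ω ∉ N := by
    simpa using measure_eq_zero_iff_ae_notMem.1 h0
  refine measure_eq_zero_iff_ae_notMem.2 ((hkey a).2 ?_)
  filter_upwards [(hkey 0).1 hN0] with w hw
  have hvol := (measurePreserving_add_left (volume : Measure ℝ) a).quasiMeasurePreserving.ae
    (hvX.ae_le hw)
  filter_upwards [hXv.ae_le hvol] with x hx
  simpa only [zero_add] using hx

/-! ### Independence criteria -/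

/-- Independence from a vector `Y` can be tested on the linear functionals of `Y`, by comparing
characteristic functions (Cramér–Wold). -/
theorem indepFun_of_forall_strongDual {Ω F : Type*} {mΩ : MeasurableSpace Ω} {P : Measure Ω}
    [IsFiniteMeasure P] [NormedAddCommGroup F] [NormedSpace ℝ F] [MeasurableSpace F]
    [BorelSpace F] [SecondCountableTopology F] [CompleteSpace F]
    {f : Ω → ℝ} {Y : Ω → F} (hf : AEMeasurable f P) (hY : AEMeasurable Y P)
    (h : ∀ L : StrongDual ℝ F, IndepFun f (fun ω => L (Y ω)) P) : IndepFun f Y P := by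
  rw [indepFun_iff_charFunDual_prod hf hY]
  intro L
  have h₁ := (indepFun_iff_charFunDual_prod hf (by fun_prop)).1 (h (L.comp (.inr ℝ ℝ F)))
    ((L.comp (.inl ℝ ℝ F)).coprod (.id ℝ ℝ))
  simp only [charFunDual_apply] at h₁ ⊢
  rw [integral_map (by fun_prop) (by fun_prop), integral_map (by fun_prop) (by fun_prop),
    integral_map (by fun_prop) (by fun_prop)] at h₁ ⊢
  simp only [ContinuousLinearMap.coe_comp, Function.comp_apply, ContinuousLinearMap.inl_apply,
    ContinuousLinearMap.inr_apply, ContinuousLinearMap.coprod_apply, map_zero, zero_add, add_zero,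
    ContinuousLinearMap.coe_id', id] at h₁ ⊢
  rw [← h₁]
  congr! with ω
  rw [← map_add]
  simp

theorem ae_eq_const_of_indepFun_self {Ω : Type*} {mΩ : MeasurableSpace Ω} {P : Measure Ω}
    [IsProbabilityMeasure P] {f : Ω → ℝ} (hf : Measurable f) (h : IndepFun f f P) :
    ∃ c, f =ᵐ[P] fun _ => c := by
  refine Filter.exists_eventuallyEq_const_of_forall_separating (l := ae P) MeasurableSet
    fun U hU => ?_
  have hm : MeasurableSet (f ⁻¹' U) := hf hU
  rcases measure_eq_zero_or_one_of_indep_self (h : Indep _ _ P) ⟨U, hU, rfl⟩ with h0 | h1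
  · exact Or.inr (measure_eq_zero_iff_ae_notMem.1 h0)
  · exact Or.inl ((prob_compl_eq_zero_iff hm).2 h1)

/-! ### Coordinates on the path space -/

section Path

variable {d : ℕ} {T : ℝ}

instance PathSpace.secondCountableTopology : SecondCountableTopology (PathSpace d T) :=
  inferInstanceAs (SecondCountableTopology
    (PathSpace d T : Set C(Set.Icc (0 : ℝ) T, EuclideanSpace ℝ (Fin d))))

instance PathSpace.measurableAdd₂ : MeasurableAdd₂ (PathSpace d T) where
  measurable_add := Continuous.measurable <|
    ((continuous_subtype_val.comp continuous_fst).add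
      (continuous_subtype_val.comp continuous_snd)).subtype_mk _

instance PathSpace.measurableSub₂ : MeasurableSub₂ (PathSpace d T) where
  measurable_sub := Continuous.measurable <|
    ((continuous_subtype_val.comp continuous_fst).sub
      (continuous_subtype_val.comp continuous_snd)).subtype_mk _

instance PathSpace.measurableSMul₂ : MeasurableSMul₂ ℝ (PathSpace d T) where
  measurable_smul := Continuous.measurable <|
    (continuous_fst.smul (continuous_subtype_val.comp continuous_snd)).subtype_mk _

/-- The real-valued coordinates `ω ↦ ω_t^j` of a path, indexed by pairs `p = (t, j)`. -/
def scalarCoord (d : ℕ) (T : ℝ) (p : Set.Icc (0 : ℝ) T × Fin d) (ω : PathSpace d T) : ℝ :=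
  coordProcess d T p.1 ω p.2

theorem continuous_coordProcess (t : Set.Icc (0 : ℝ) T) : Continuous (coordProcess d T t) := by
  unfold coordProcess
  fun_prop

theorem measurable_coordProcess (t : Set.Icc (0 : ℝ) T) : Measurable (coordProcess d T t) :=
  (continuous_coordProcess t).measurable

theorem measurable_scalarCoord (p : Set.Icc (0 : ℝ) T × Fin d) :
    Measurable (scalarCoord d T p) := by
  have := measurable_coordProcess (d := d) p.1
  unfold scalarCoord
  fun_prop

theorem scalarCoord_add (q : Set.Icc (0 : ℝ) T × Fin d) (ω η : PathSpace d T) :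
    scalarCoord d T q (ω + η) = scalarCoord d T q ω + scalarCoord d T q η := rfl

theorem scalarCoord_smul (q : Set.Icc (0 : ℝ) T × Fin d) (a : ℝ) (ω : PathSpace d T) :
    scalarCoord d T q (a • ω) = a * scalarCoord d T q ω := rfl

theorem scalarCoord_sub (q : Set.Icc (0 : ℝ) T × Fin d) (ω η : PathSpace d T) :
    scalarCoord d T q (ω - η) = scalarCoord d T q ω - scalarCoord d T q η := rfl

theorem PathSpace.isClosed : IsClosed (PathSpace d T : Set C(Set.Icc (0 : ℝ) T,
    EuclideanSpace ℝ (Fin d))) := by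
  have : (PathSpace d T : Set C(Set.Icc (0 : ℝ) T, EuclideanSpace ℝ (Fin d))) =
      ⋂ (t : Set.Icc (0 : ℝ) T) (_ : (t : ℝ) = 0), {ω | ω t = 0} := by
    ext ω
    simp [PathSpace]
  rw [this]
  exact isClosed_iInter fun t => isClosed_iInter fun _ =>
    isClosed_eq (ContinuousEvalConst.continuous_eval_const t) continuous_const

/-- The Borel `σ`-algebra of the path space is generated by the real coordinates: countably many of
them (at a dense sequence of times) define a measurable injection of a Polish space, which is a
measurable embedding by the Lusin–Souslin theorem. -/
theorem comap_scalarCoord [Fact (0 ≤ T)] :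
    MeasurableSpace.comap (fun (ω : PathSpace d T) p => scalarCoord d T p ω) MeasurableSpace.pi =
      PathSpace.instMeasurableSpace d T := by
  have hm : Measurable (fun (ω : PathSpace d T) p => scalarCoord d T p ω) :=
    measurable_pi_lambda _ measurable_scalarCoord
  refine le_antisymm hm.comap_le ?_
  have : Nonempty (Set.Icc (0 : ℝ) T) := ⟨⊥⟩
  have : CompleteSpace (PathSpace d T) := PathSpace.isClosed.isComplete.completeSpace_coe
  have : PolishSpace (PathSpace d T) := inferInstance
  let r : (Set.Icc (0 : ℝ) T × Fin d → ℝ) → (ℕ × Fin d → ℝ) :=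
    fun x q => x (TopologicalSpace.denseSeq _ q.1, q.2)
  have hr : Measurable r := by fun_prop
  have hinj : Function.Injective (r ∘ fun (ω : PathSpace d T) p => scalarCoord d T p ω) := by
    intro ω η h
    refine Subtype.ext (DFunLike.coe_injective ?_)
    refine (TopologicalSpace.denseRange_denseSeq (Set.Icc (0 : ℝ) T)).equalizer
      ω.1.continuous η.1.continuous ?_
    ext n j
    exact congrFun h (n, j)
  rw [← ((hr.comp hm).measurableEmbedding hinj).comap_eq, ← MeasurableSpace.comap_comp]
  exact MeasurableSpace.comap_mono hr.comap_le

/-- Measurability with respect to the augmented filtration gives a Borel modification. -/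
theorem aemeasurable_of_measurable_augFiltration {P : Measure (PathSpace d T)} {s : ℝ}
    {f : PathSpace d T → ℝ}
    (hf : Measurable[augFiltration P s] f) : AEMeasurable f P := by
  refine NullMeasurable.aemeasurable fun U hU => ?_
  have hle : augFiltration P s ≤ NullMeasurableSpace.instMeasurableSpace (μ := P) :=
    sup_le (iSup₂_le fun r _ => ((measurable_coordProcess r).comap_le).trans
      fun A hA => MeasurableSet.nullMeasurableSet hA)
      (MeasurableSpace.generateFrom_le fun N hN => NullMeasurableSet.of_null hN)
  exact hle _ (hf hU)

/-! ### Cameron–Martin paths dual to finite combinations of coordinates -/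

theorem smul_mem_cameronMartin {h : PathSpace d T} (hh : h ∈ cameronMartin d T) (c : ℝ) :
    c • h ∈ cameronMartin d T := by
  obtain ⟨φ, hφ, hint⟩ := hh
  refine ⟨c • φ, hφ.const_smul c, fun t => ?_⟩
  simp [hint, intervalIntegral.integral_smul]

theorem add_mem_cameronMartin {g h : PathSpace d T} (hg : g ∈ cameronMartin d T)
    (hh : h ∈ cameronMartin d T) : g + h ∈ cameronMartin d T := by
  obtain ⟨φ, hφ, hφi⟩ := hg
  obtain ⟨ψ, hψ, hψi⟩ := hh
  refine ⟨φ + ψ, hφ.add hψ, fun t => ?_⟩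
  have key : ∀ χ : ℝ → EuclideanSpace ℝ (Fin d),
      MemLp χ 2 (volume.restrict (Set.Icc (0 : ℝ) T)) → IntervalIntegrable χ volume 0 t := by
    intro χ hχ
    have : IntegrableOn χ (Set.Icc 0 T) := hχ.integrable (by norm_num)
    rw [intervalIntegrable_iff_integrableOn_Icc_of_le t.2.1]
    exact this.mono_set (Set.Icc_subset_Icc_right t.2.2)
  simp [hφi, hψi, intervalIntegral.integral_add (key φ hφ) (key ψ hψ)]

theorem zero_mem_cameronMartin : (0 : PathSpace d T) ∈ cameronMartin d T :=
  ⟨0, MemLp.zero, fun t => by simp⟩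

/-- For `p = (s, j)`, the path `t ↦ min(t, s) e_j`. It represents the coordinate at `p` in the
Cameron–Martin space: its coordinates are the covariances with that coordinate under the Wiener
measure. -/
noncomputable def minPath (p : Set.Icc (0 : ℝ) T × Fin d) : PathSpace d T :=
  ⟨⟨fun t => EuclideanSpace.single p.2 (min (t : ℝ) p.1), by
      have : Continuous fun x : ℝ => EuclideanSpace.single p.2 x :=
        (PiLp.continuous_toLp 2 _).comp (continuous_single (A := fun _ => ℝ) p.2)
      fun_prop⟩,
    fun t ht => by simp [ht, p.1.2.1]⟩

theorem scalarCoord_minPath (p q : Set.Icc (0 : ℝ) T × Fin d) :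
    scalarCoord d T q (minPath p) = if q.2 = p.2 then min (q.1 : ℝ) p.1 else 0 := by
  simp [scalarCoord, coordProcess, minPath]

theorem minPath_mem_cameronMartin (p : Set.Icc (0 : ℝ) T × Fin d) :
    minPath p ∈ cameronMartin d T := by
  refine ⟨(Set.Iic (p.1 : ℝ)).indicator fun _ => EuclideanSpace.single p.2 1,
    (memLp_const _).indicator measurableSet_Iic, fun t => ?_⟩
  rw [intervalIntegral.integral_of_le t.2.1, setIntegral_indicator measurableSet_Iic,
    setIntegral_const, Set.Ioc_inter_Iic]
  ext j
  simp [minPath, max_eq_left (le_min (t.2.1) (p.1.2.1))]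

/-- The linear functional `∑ p ∈ I, c p * ω_p` of finitely many coordinates. -/
noncomputable def coordSum (I : Finset (Set.Icc (0 : ℝ) T × Fin d))
    (c : Set.Icc (0 : ℝ) T × Fin d → ℝ) (ω : PathSpace d T) : ℝ :=
  ∑ p ∈ I, c p * scalarCoord d T p ω

/-- The Cameron–Martin path representing the functional `coordSum I c`. -/
noncomputable def coordSumPath (I : Finset (Set.Icc (0 : ℝ) T × Fin d))
    (c : Set.Icc (0 : ℝ) T × Fin d → ℝ) : PathSpace d T :=
  ∑ p ∈ I, c p • minPath p

variable {I : Finset (Set.Icc (0 : ℝ) T × Fin d)} {c : Set.Icc (0 : ℝ) T × Fin d → ℝ}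

theorem coordSumPath_mem_cameronMartin : coordSumPath I c ∈ cameronMartin d T :=
  Finset.sum_induction _ (· ∈ cameronMartin d T) (fun _ _ => add_mem_cameronMartin)
    zero_mem_cameronMartin fun p _ => smul_mem_cameronMartin (minPath_mem_cameronMartin p) (c p)

theorem measurable_coordSum : Measurable (coordSum I c) := by
  have := measurable_scalarCoord (d := d) (T := T)
  unfold coordSum
  fun_prop

/-! ### Gaussian structure of the Wiener measure -/

section Wiener

variable [Fact (0 ≤ T)] {P : Measure (PathSpace d T)}

theorem coordProcess_bot (ω : PathSpace d T) : coordProcess d T ⊥ ω = 0 :=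
  ω.2 ⊥ (Set.Icc.coe_bot 0 T)

theorem IsWienerMeasure.hasLaw_coordProcess (hP : IsWienerMeasure P) (t : Set.Icc (0 : ℝ) T) :
    HasLaw (coordProcess d T t) (multivariateGaussian (0 : EuclideanSpace ℝ (Fin d))
      ((t : ℝ) • (1 : Matrix (Fin d) (Fin d) ℝ))) P := by
  simpa [coordProcess_bot] using hP.hasLaw_increment ⊥ t bot_le

theorem IsWienerMeasure.isGaussianProcess_coordProcess (hP : IsWienerMeasure P) :
    IsGaussianProcess (coordProcess d T) P :=
  hP.hasIndepIncrements.isGaussianProcess (fun t => (hP.hasLaw_coordProcess t).hasGaussianLaw)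
    (ae_of_all _ coordProcess_bot)

theorem IsWienerMeasure.isGaussianProcess_scalarCoord (hP : IsWienerMeasure P) :
    IsGaussianProcess (scalarCoord d T) P :=
  (hP.isGaussianProcess_coordProcess.comp_right Prod.fst).comp_left
    fun p : Set.Icc (0 : ℝ) T × Fin d => EuclideanSpace.proj p.2

theorem IsWienerMeasure.memLp_scalarCoord (hP : IsWienerMeasure P)
    (p : Set.Icc (0 : ℝ) T × Fin d) : MemLp (scalarCoord d T p) 2 P :=
  (hP.isGaussianProcess_scalarCoord.hasGaussianLaw_eval p).memLp_two

theorem IsWienerMeasure.covariance_scalarCoord_of_le (hP : IsWienerMeasure P)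
    {s t : Set.Icc (0 : ℝ) T} (hst : s ≤ t) (i j : Fin d) :
    cov[scalarCoord d T (s, i), scalarCoord d T (t, j); P] = if i = j then (s : ℝ) else 0 := by
  have := hP.isProbabilityMeasure
  have hi : IndepFun (scalarCoord d T (s, i))
      (scalarCoord d T (t, j) - scalarCoord d T (s, j)) P :=
    (hP.hasIndepIncrements.indepFun_eval_sub bot_le hst (ae_of_all _ coordProcess_bot)).comp
      (φ := fun x : EuclideanSpace ℝ (Fin d) => x i) (ψ := fun x : EuclideanSpace ℝ (Fin d) => x j)
      (by fun_prop) (by fun_prop)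
  have hS : ((s : ℝ) • (1 : Matrix (Fin d) (Fin d) ℝ)).PosSemidef :=
    Matrix.PosSemidef.one.smul s.2.1
  have hs : cov[scalarCoord d T (s, i), scalarCoord d T (s, j); P] =
      if i = j then (s : ℝ) else 0 := by
    have := covariance_eval_multivariateGaussian (μ := 0) hS i j
    rw [← (hP.hasLaw_coordProcess s).map_eq, covariance_map] at this
    · exact this.trans (by simp [Matrix.one_apply])
    all_goals first | fun_prop | exact (measurable_coordProcess s).aemeasurable
  rw [← hs, ← sub_eq_zero, ← covariance_sub_right (hP.memLp_scalarCoord _)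
    (hP.memLp_scalarCoord _) (hP.memLp_scalarCoord _)]
  exact hi.covariance_eq_zero (hP.memLp_scalarCoord _)
    ((hP.memLp_scalarCoord _).sub (hP.memLp_scalarCoord _))

theorem IsWienerMeasure.covariance_scalarCoord (hP : IsWienerMeasure P)
    (q p : Set.Icc (0 : ℝ) T × Fin d) :
    cov[scalarCoord d T q, scalarCoord d T p; P] = scalarCoord d T q (minPath p) := by
  rw [scalarCoord_minPath]
  rcases le_total q.1 p.1 with h | h
  · rw [hP.covariance_scalarCoord_of_le h, min_eq_left (Subtype.coe_le_coe.2 h)]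
  · rw [covariance_comm, hP.covariance_scalarCoord_of_le h, min_eq_right (Subtype.coe_le_coe.2 h)]
    simp only [eq_comm]

theorem IsWienerMeasure.memLp_coordSum (hP : IsWienerMeasure P) : MemLp (coordSum I c) 2 P :=
  memLp_finsetSum I fun p _ => (hP.memLp_scalarCoord p).const_mul (c p)

/-- The representing path of a functional records its covariances with all coordinates. -/
theorem IsWienerMeasure.covariance_scalarCoord_coordSum (hP : IsWienerMeasure P)
    (q : Set.Icc (0 : ℝ) T × Fin d) :
    cov[scalarCoord d T q, coordSum I c; P] = scalarCoord d T q (coordSumPath I c) := by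
  have := hP.isProbabilityMeasure
  have h₁ : cov[scalarCoord d T q, coordSum I c; P] =
      ∑ p ∈ I, c p * cov[scalarCoord d T q, scalarCoord d T p; P] := by
    unfold coordSum
    rw [covariance_fun_sum_right' (fun p _ => (hP.memLp_scalarCoord p).const_mul (c p))
      (hP.memLp_scalarCoord q)]
    simp only [covariance_const_mul_right]
  have h₂ : ∀ J : Finset (Set.Icc (0 : ℝ) T × Fin d), scalarCoord d T q (coordSumPath J c) =
      ∑ p ∈ J, c p * scalarCoord d T q (minPath p) := by
    classical
    intro J
    induction J using Finset.induction_on with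
    | empty => rfl
    | insert p J hp ih =>
      simp only [coordSumPath] at ih ⊢
      rw [Finset.sum_insert hp, Finset.sum_insert hp, scalarCoord_add, scalarCoord_smul, ih]
  simp only [h₁, h₂, hP.covariance_scalarCoord]

/-- The coordinates of `ω - X ω • k` together with `X = coordSum I c` form a Gaussian process, all of
them being finite linear combinations of coordinates of `ω`. -/
theorem IsWienerMeasure.isGaussianProcess_residual (hP : IsWienerMeasure P) (k : PathSpace d T) :
    IsGaussianProcess (Sum.elim (fun q ω => scalarCoord d T q (ω - coordSum I c ω • k))
      (fun (_ : Unit) => coordSum I c)) P := by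
  classical
  refine hP.isGaussianProcess_scalarCoord.of_isGaussianProcess ?_
  rintro (q | -)
  · refine ⟨insert q I, .proj ⟨q, by simp⟩ - scalarCoord d T q k •
      ∑ p : I, c p • .proj ⟨(p : Set.Icc (0 : ℝ) T × Fin d), by simp⟩, fun ω => ?_⟩
    simp [coordSum, scalarCoord_sub, scalarCoord_smul, ← Finset.sum_coe_sort I, mul_comm]
  · exact ⟨I, ∑ p : I, c p • .proj p, fun ω => by simp [coordSum, ← Finset.sum_coe_sort I]⟩

theorem IsWienerMeasure.hasGaussianLaw_coordSum (hP : IsWienerMeasure P) :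
    HasGaussianLaw (coordSum I c) P :=
  (hP.isGaussianProcess_residual 0).hasGaussianLaw_eval (Sum.inr ())

/-- The orthogonal decomposition of a Brownian path: with `X = coordSum I c` and `h` its representing
path, `ω - X ω • (Var[X]⁻¹ • h)` has coordinates uncorrelated with `X`, hence is independent of
`X` by joint Gaussianity. -/
theorem IsWienerMeasure.indepFun_residual (hP : IsWienerMeasure P)
    (hv : Var[coordSum I c; P] ≠ 0) :
    IndepFun (fun ω => ω - coordSum I c ω • ((Var[coordSum I c; P])⁻¹ • coordSumPath I c))
      (coordSum I c) P := by
  have := hP.isProbabilityMeasure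
  set v := Var[coordSum I c; P] with hvdef
  set k := v⁻¹ • coordSumPath I c with hk
  have hW : Measurable fun ω : PathSpace d T => ω - coordSum I c ω • k := by
    have := measurable_coordSum (I := I) (c := c)
    fun_prop
  have hind := (hP.isGaussianProcess_residual (I := I) (c := c) k).indepFun_of_covariance_eq_zero
    (fun q => ((measurable_scalarCoord q).comp hW).aemeasurable)
    (fun _ => measurable_coordSum.aemeasurable) fun q _ => by
      have : (fun ω => scalarCoord d T q (ω - coordSum I c ω • k)) =
          scalarCoord d T q - scalarCoord d T q k • coordSum I c := by
        ext ω
        simp [scalarCoord_sub, scalarCoord_smul, mul_comm]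
      rw [this, covariance_sub_left (hP.memLp_scalarCoord q) (hP.memLp_coordSum.const_smul _)
        hP.memLp_coordSum, covariance_smul_left, hP.covariance_scalarCoord_coordSum,
        covariance_self measurable_coordSum.aemeasurable, ← hvdef, hk, scalarCoord_smul]
      field_simp
      simp
  have hind' := hind.comp (φ := id) (ψ := fun x : Unit → ℝ => x ()) measurable_id
    (measurable_pi_apply (X := fun _ : Unit => ℝ) ())
  rw [IndepFun_iff_Indep] at hind' ⊢
  have hcomap : MeasurableSpace.comap (fun ω : PathSpace d T => ω - coordSum I c ω • k)
      (PathSpace.instMeasurableSpace d T) = MeasurableSpace.comap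
        (fun ω q => scalarCoord d T q (ω - coordSum I c ω • k)) MeasurableSpace.pi := by
    rw [← comap_scalarCoord, MeasurableSpace.comap_comp]
    rfl
  rw [hcomap]
  exact hind'

/-- A shift-invariant random variable `g` is independent of each finite linear combination of
coordinates. The statement is about a Borel modification `f` of `g`; it inherits the invariance
because the shifts involved preserve null sets. -/
theorem IsWienerMeasure.indepFun_coordSum (hP : IsWienerMeasure P)
    {f g : PathSpace d T → ℝ} (hf : Measurable f) (hfg : f =ᵐ[P] g)
    (hinv : ∀ h ∈ cameronMartin d T, ∀ᵐ ω ∂P, g (shift h ω) = g ω) :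
    IndepFun f (coordSum I c) P := by
  have := hP.isProbabilityMeasure
  by_cases hv : Var[coordSum I c; P] = 0
  · -- a functional of zero variance is a.s. constant, and has no direction to shift along
    have hconst : coordSum I c =ᵐ[P] fun _ => ∫ ω, coordSum I c ω ∂P :=
      ae_eq_integral_of_variance_eq_zero hP.memLp_coordSum hv
    exact (indepFun_const_right f _).congr .rfl hconst.symm
  · have hv' : (Var[coordSum I c; P]).toNNReal ≠ 0 := by
      simpa using lt_of_le_of_ne (variance_nonneg _ _) (Ne.symm hv)
    have hlaw := hP.hasGaussianLaw_coordSum (I := I) (c := c) |>.map_eq_gaussianReal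
    have hk : (Var[coordSum I c; P])⁻¹ • coordSumPath I c ∈ cameronMartin d T :=
      smul_mem_cameronMartin coordSumPath_mem_cameronMartin _
    have hres := hP.indepFun_residual hv
    generalize (Var[coordSum I c; P])⁻¹ • coordSumPath I c = k at hk hres
    have hW : Measurable fun ω : PathSpace d T => ω - coordSum I c ω • k := by
      have := measurable_coordSum (I := I) (c := c)
      fun_prop
    have hWX : ∀ ω, ω - coordSum I c ω • k + coordSum I c ω • k = ω := fun ω =>
      sub_add_cancel ω _
    refine indepFun_of_shift_invariant hW hWX hres hf fun a => ?_
    have hq := quasiMeasurePreserving_smul_add measurable_coordSum hW hWX hres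
      (hlaw ▸ gaussianReal_absolutelyContinuous _ hv')
      (hlaw ▸ gaussianReal_absolutelyContinuous' _ hv') a
    filter_upwards [hfg, hq.ae hfg, hinv _ (smul_mem_cameronMartin hk a)] with ω h₁ h₂ h₃
    rw [h₂, h₁, ← h₃, shift, add_comm]

/-- A shift-invariant random variable is independent of the whole path, so of itself. -/
theorem IsWienerMeasure.indepFun_self (hP : IsWienerMeasure P)
    {f : PathSpace d T → ℝ} (hf : Measurable f)
    {g : PathSpace d T → ℝ} (hfg : f =ᵐ[P] g)
    (hinv : ∀ h ∈ cameronMartin d T, ∀ᵐ ω ∂P, g (shift h ω) = g ω) :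
    IndepFun f f P := by
  have := hP.isProbabilityMeasure
  have hproc : IndepFun f (fun ω p => scalarCoord d T p ω) P := by
    refine IndepFun.indepFun_process hf measurable_scalarCoord fun J => ?_
    refine indepFun_of_forall_strongDual hf.aemeasurable
      (measurable_pi_lambda _ fun p => measurable_scalarCoord _).aemeasurable fun L => ?_
    classical
    -- `coordSum` takes coefficients on all coordinates: those of `L` are extended by zero
    have hL : (fun ω => L fun p : J => scalarCoord d T p ω) =
        coordSum J fun p => if hp : p ∈ J then L (Pi.single ⟨p, hp⟩ 1) else 0 := by
      ext ω
      refine (L.toLinearMap.pi_apply_eq_sum_univ _).trans ?_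
      rw [coordSum, ← Finset.sum_coe_sort J]
      refine Finset.sum_congr rfl fun p _ => ?_
      have hs : (Pi.single p 1 : J → ℝ) = fun q => if p = q then 1 else 0 := by
        ext q
        simp [Pi.single_apply, eq_comm]
      rw [dif_pos p.2, smul_eq_mul, mul_comm, hs]
      rfl
    rw [hL]
    exact hP.indepFun_coordSum hf hfg hinv
  rw [IndepFun_iff_Indep] at hproc ⊢
  rw [comap_scalarCoord] at hproc
  exact indep_of_indep_of_le_right hproc hf.comap_le

end Wiener

end Path

theorem lemma4p1 (d : ℕ) (T : ℝ) (hT : 0 < T)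
    (P : Measure (PathSpace d T)) (hP : IsWienerMeasure P)
    (ζ : PathSpace d T → ℝ) (hζ : Measurable[augFiltration P T] ζ)
    (hinv : ∀ h ∈ cameronMartin d T, ∀ᵐ ω ∂P, ζ (shift h ω) = ζ ω) :
    Integrable ζ P ∧ ∀ᵐ ω ∂P, ζ ω = ∫ ω', ζ ω' ∂P := by
  have := hP.isProbabilityMeasure
  have : Fact (0 ≤ T) := ⟨hT.le⟩
  have hae := aemeasurable_of_measurable_augFiltration hζ
  obtain ⟨c, hc⟩ := ae_eq_const_of_indepFun_self hae.measurable_mk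
    (hP.indepFun_self hae.measurable_mk hae.ae_eq_mk.symm hinv)
  have hζc : ζ =ᵐ[P] fun _ => c := hae.ae_eq_mk.trans hc
  refine ⟨(integrable_const c).congr hζc.symm, ?_⟩
  rw [integral_congr_ae hζc]
  filter_upwards [hζc] with ω hω
  simpa using hω
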